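/- Let $\mathbb{F}$ be a field with algebraic closure $\overline{\mathbb{F}}$, let $d,e\ge 1$ be integers and $n=de$. Let $P_d(\overline{\mathbb{F}})$ be the set of monic polynomials of degree $d$ in $\overline{\mathbb{F}}[X]$, and let $P_e^*(\overline{\mathbb{F}})$ be the set of monic polynomials of degree $e$ in $\overline{\mathbb{F}}[X]$ with constant coefficient $0$. Identify $g=X^d+g_{d-1}X^{d-1}+\cdots+g_0\in P_d(\overline{\mathbb{F}})$ with $(g_{d-1},\ldots,g_0)\in\overline{\mathbb{F}}^{d}$ and $h=X^e+h_{e-1}X^{e-1}+\cdots+h_1X\in P_e^*(\overline{\mathbb{F}})$ with $(h_{e-1},\ldots,h_1)\in\overline{\mathbb{F}}^{e-1}$. Consider the incidence variety $$\Gamma_{n,d}=\{(g,h,\boldsymbol\alpha,\boldsymbol\beta)\in P_d(\overline{\mathbb{F}})\times P_e^*(\overline{\mathbb{F}})\times\overline{\mathbb{F}}^{\,d+e-1}\times\overline{\mathbb{F}}^{\,d+e-1}:\ (g\circ h)(\alpha_i)=\beta_i\ \text{ for } 1\le i\le d+e-1\}$$ in the affine space $\overline{\mathbb{F}}^{\,3(d+e-1)}$.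 Then: 1. $\Gamma_{n,d}$ is a Zariski-closed set defined over $\mathbb{F}$; that is, it is the set of common zeros of polynomials with coefficients in $\mathbb{F}$ that generate the ideal of all polynomials over $\overline{\mathbb{F}}$ vanishing on $\Gamma_{n,d}$. 2. $\Gamma_{n,d}$ is irreducible in the Zariski topology over $\overline{\mathbb{F}}$. 3. $\dim\Gamma_{n,d}=2(d+e-1)$. 4. $\deg\Gamma_{n,d}\le n^{d+e-1}$. Here the dimension is the Krull dimension for the Zariski topology, and the degree of an irreducible variety $V\subseteq\overline{\mathbb{F}}^{N}$ of dimension $r$ is the supremum of the cardinalities of the finite sets $V\cap E$, where $E$ ranges over the affine linear subspaces of $\overline{\mathbb{F}}^{N}$ of dimension $N-r$. -/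

import Mathlib

namespace DecompInterp

open Polynomial

section Zariski

variable {σ K : Type*} [Field K]

/-- The Zariski topology on affine space `K^σ`: the closed sets are the common zero sets of
polynomials with coefficients in `K`. -/
@[reducible] def zariskiTopology (σ K : Type*) [Field K] : TopologicalSpace (σ → K) :=
  TopologicalSpace.ofClosed
    (Set.range (fun I : Ideal (MvPolynomial σ K) => MvPolynomial.zeroLocus K I))
    ⟨⊤, MvPolynomial.zeroLocus_top⟩
    (by
      intro A hA
      refine ⟨sSup {I | MvPolynomial.zeroLocus K I ∈ A}, ?_⟩
      ext x
      simp only [Set.mem_sInter]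
      constructor
      · intro hx V hV
        obtain ⟨I, rfl⟩ := hA hV
        exact MvPolynomial.zeroLocus_anti_mono (le_sSup hV) hx
      · intro hx
        have hle : sSup {I | MvPolynomial.zeroLocus K I ∈ A} ≤
            MvPolynomial.vanishingIdeal K {x} := by
          refine sSup_le fun I hI => ?_
          rw [← MvPolynomial.le_zeroLocus_iff_le_vanishingIdeal]
          exact Set.singleton_subset_iff.2 (hx _ hI)
        exact MvPolynomial.le_zeroLocus_iff_le_vanishingIdeal.2 hle rfl)
    (by
      rintro _ ⟨I, rfl⟩ _ ⟨J, rfl⟩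
      refine ⟨I ⊓ J, ?_⟩
      ext x
      constructor
      · intro hx
        by_contra hcon
        simp only [Set.mem_union, MvPolynomial.mem_zeroLocus_iff, not_or, not_forall] at hcon
        obtain ⟨⟨p, hp, hpx⟩, q, hq, hqx⟩ := hcon
        have h := hx (p * q) ⟨I.mul_mem_right q hp, J.mul_mem_left p hq⟩
        rw [map_mul] at h
        exact (mul_ne_zero hpx hqx) h
      · rintro (hx | hx)
        · exact MvPolynomial.zeroLocus_anti_mono inf_le_left hx
        · exact MvPolynomial.zeroLocus_anti_mono inf_le_right hx)

/-- Irreducibility (in particular nonemptiness) in the Zariski topology of `K^σ`. -/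
def IsZariskiIrreducible (V : Set (σ → K)) : Prop :=
  @IsIrreducible _ (zariskiTopology σ K) V

/-- The dimension of `V ⊆ K^σ`: the supremum of the lengths of chains of irreducible closed
subsets of `V`, for the topology induced by the Zariski topology. -/
noncomputable def zariskiDim (V : Set (σ → K)) : WithBot ℕ∞ :=
  @topologicalKrullDim V (@instTopologicalSpaceSubtype _ (· ∈ V) (zariskiTopology σ K))

/-- The degree of an irreducible affine variety `V ⊆ K^σ` (`σ` finite, `K` algebraically closed):
the supremum of the cardinalities of the finite sets `V ∩ E`, where `E` runs through the affine
linear subspaces of `K^σ` whose dimension is complementary to that of `V`. -/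
noncomputable def degreeOfIrreducible (V : Set (σ → K)) : ℕ∞ :=
  sSup {c | ∃ E : AffineSubspace K (σ → K), (E : Set (σ → K)).Nonempty ∧
    ((Module.finrank K E.direction : ℕ) : WithBot ℕ∞) + zariskiDim V = (Nat.card σ : ℕ) ∧
    (V ∩ E).Finite ∧ c = (V ∩ E).encard}

/-- `V ⊆ K^σ` is a variety defined over the subfield `F`: it is the zero set of an ideal of
polynomials over `F` that generates the ideal of all polynomials over `K` vanishing on `V`. -/
def IsDefinedOver (F : Type*) [Field F] [Algebra F K] (V : Set (σ → K)) : Prop :=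
  ∃ I : Ideal (MvPolynomial σ F), MvPolynomial.zeroLocus K I = V ∧
    MvPolynomial.vanishingIdeal K V = I.map (MvPolynomial.map (algebraMap F K))

end Zariski

section Incidence

variable (K : Type*) [Field K] (d e : ℕ)

/-- The monic polynomials of degree `d`. -/
def monicPolys : Set K[X] := {f | f.Monic ∧ f.natDegree = d}

/-- The monic polynomials of degree `e` that are original, i.e. have constant coefficient `0`. -/
def monicOriginalPolys : Set K[X] := {h | h ∈ monicPolys K e ∧ h.coeff 0 = 0}

/-- The set of all `(g, h, α, β)` with `g` monic of degree `d`, `h` monic original of degree `e`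
and `(g ∘ h)(α i) = β i` for all `i`. -/
def incidenceSet :
    Set (K[X] × K[X] × (Fin (d + e - 1) → K) × (Fin (d + e - 1) → K)) :=
  {t | t.1 ∈ monicPolys K d ∧ t.2.1 ∈ monicOriginalPolys K e ∧
    ∀ i, (t.1.comp t.2.1).eval (t.2.2.1 i) = t.2.2.2 i}

/-- The coordinates on the ambient affine space of dimension `3 (d + e - 1)`: the coefficients
`g_0, …, g_{d-1}` of `g`, the coefficients `h_1, …, h_{e-1}` of `h`, and the entries of `α`
and `β`. -/
abbrev CoordIndex : Type :=
  Fin d ⊕ Fin (e - 1) ⊕ Fin (d + e - 1) ⊕ Fin (d + e - 1)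

variable {K} in
/-- The coordinate vector of `(g, h, α, β)`. -/
def coordVector (t : K[X] × K[X] × (Fin (d + e - 1) → K) × (Fin (d + e - 1) → K)) :
    CoordIndex d e → K :=
  Sum.elim (fun i : Fin d => t.1.coeff i)
    (Sum.elim (fun j : Fin (e - 1) => t.2.1.coeff (j + 1)) (Sum.elim t.2.2.1 t.2.2.2))

/-- The incidence variety, as a subset of affine space: a monic polynomial `g` of degree `d` is
identified with its coefficients `g_0, …, g_{d-1}`, and a monic original polynomial `h` of
degree `e` with its coefficients `h_1, …, h_{e-1}`. -/
def incidenceVariety : Set (CoordIndex d e → K) :=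
  coordVector d e '' incidenceSet K d e

end Incidence

end DecompInterp

/-! The equations express each `β i` as a polynomial over `F` in `g`, `h` and `α`, so the variety is
the graph of a polynomial map on affine space of dimension `d + (e - 1) + (d + e - 1)`. A graph is
the image of an irreducible space, is homeomorphic to its space of parameters, and has its ideal
generated by the equations of the graph. This gives the first three claims.

For the degree, parametrize `E` affinely by `m = d + e - 1` variables. The intersection becomes the
zero set of `m` polynomials of degree at most `D = d * e`, and Bézout's inequality
`ncard_zeros_le_pow` bounds it by `D ^ m`.

Bézout is proved by deforming `f i` to `f i + t X_i ^ D`. Monomials with some exponent at least `D`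
can be traded away, so more than `D ^ m` polynomials are dependent over `K[t]` modulo the
deformation (`exists_relation_mod_powDeformation`). Were there too many zeros, apply this to
polynomials separating them. Each zero at `t = 0` lies on a component where `t` is not identically
zero (`exists_prime_notMem_of_finite`), so common powers of `t` can be cancelled there; setting `t =
0` then kills a coefficient chosen to be nonzero. -/

open MvPolynomial

/-! ### Linear dependence modulo the deformed equations. -/

namespace MvPolynomial

variable {σ K : Type*} [Fintype σ] [Field K]

/-- The deformation `f i + t X_i ^ D` of the polynomials `f i`, with coefficients in `K[t]`. -/
noncomputable def powDeformation (f : σ → MvPolynomial σ K) (D : ℕ) (i : σ) :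
    MvPolynomial σ (Polynomial K) :=
  map Polynomial.C (f i) + C Polynomial.X * X i ^ D

-- A monomial multiple of a generator has the shape `u + t X ^ a` with `u` free of `t`; these
-- elements account for all monomials having an exponent at least `D`.
omit [Fintype σ] in
theorem map_mul_monomial_add_monomial_mem_span (f : σ → MvPolynomial σ K) (D : ℕ) (i : σ)
    (a : σ →₀ ℕ) (ha : D ≤ a i) :
    map Polynomial.C (f i * monomial (a - Finsupp.single i D) 1) + monomial a Polynomial.X ∈
      Ideal.span (Set.range (powDeformation f D)) := by
  have h : map Polynomial.C (f i * monomial (a - Finsupp.single i D) 1) +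
      monomial a Polynomial.X =
      monomial (a - Finsupp.single i D) 1 * powDeformation f D i := by
    have h2 : (monomial a Polynomial.X : MvPolynomial σ (Polynomial K)) =
        C Polynomial.X * X i ^ D * monomial (a - Finsupp.single i D) 1 := by
      rw [X_pow_eq_monomial, C_mul_monomial, monomial_mul, mul_one, mul_one,
        add_tsub_cancel_of_le (Finsupp.single_le_iff.2 ha)]
    rw [h2, powDeformation, map_mul, map_monomial, Polynomial.C_1]
    ring
  rw [h]
  exact Ideal.mul_mem_left _ _ (Ideal.subset_span ⟨i, rfl⟩)

omit [Fintype σ] [Field K] in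
theorem totalDegree_map_le {R S : Type*} [CommSemiring R] [CommSemiring S] (φ : R →+* S)
    (p : MvPolynomial σ R) : (map φ p).totalDegree ≤ p.totalDegree :=
  Finset.sup_mono (support_map_subset φ p)

omit [Fintype σ] in
theorem totalDegree_map_mul_monomial_add_monomial_le (f : MvPolynomial σ K) (D : ℕ)
    (hf : f.totalDegree ≤ D) (i : σ) (a : σ →₀ ℕ) (ha : D ≤ a i) :
    (map Polynomial.C (f * monomial (a - Finsupp.single i D) 1) +
      monomial a Polynomial.X).totalDegree ≤ a.sum fun _ e => e := by
  refine (totalDegree_add _ _).trans (max_le ?_ (totalDegree_monomial_le _ _))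
  refine (totalDegree_map_le _ _).trans ((totalDegree_mul _ _).trans ?_)
  refine (add_le_add hf (totalDegree_monomial_le _ _)).trans (le_of_eq ?_)
  conv_rhs => rw [← add_tsub_cancel_of_le (Finsupp.single_le_iff.2 ha)]
  rw [Finsupp.sum_add_index' (by simp) (by simp)]
  rw [Finsupp.sum_single_index rfl]; rfl

omit [Fintype σ] in
/-- The coefficient of `X ^ a` with the highest power of `t` survives in a relation between
polynomials `u a + t X ^ a`. -/
theorem eq_zero_of_sum_mul_map_add_monomial_eq_zero {ι : Type*} [Fintype ι] (a : ι → σ →₀ ℕ)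
    (ha : Function.Injective a) (u : ι → MvPolynomial σ K) (c : ι → Polynomial K)
    (h : ∑ j, C (c j) * (map Polynomial.C (u j) + monomial (a j) Polynomial.X) = 0) :
    c = 0 := by
  classical
  by_contra hc
  obtain ⟨j₀, hj₀⟩ := Function.ne_iff.1 hc
  -- Take `c j` of maximal degree in `t`. In degree one higher, the terms from `u` contribute
  -- nothing, and `X ^ (a j)` comes from the index `j` alone.
  obtain ⟨j, -, hj⟩ := Finset.exists_max_image Finset.univ (fun j => (c j).degree)
    ⟨j₀, Finset.mem_univ _⟩
  have hjne : c j ≠ 0 := by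
    intro h0
    have := hj j₀ (Finset.mem_univ _)
    rw [h0, Polynomial.degree_zero, le_bot_iff, Polynomial.degree_eq_bot] at this
    exact hj₀ this
  have h1 := congrArg (fun p => (coeff (a j) p).coeff ((c j).natDegree + 1)) h
  have h2 : ∀ k, (coeff (a j) (C (c k) *
      (map Polynomial.C (u k) + monomial (a k) Polynomial.X))).coeff ((c j).natDegree + 1) =
      if k = j then (c j).leadingCoeff else 0 := by
    intro k
    have hk : (c k).coeff ((c j).natDegree + 1) = 0 := by
      apply Polynomial.coeff_eq_zero_of_degree_lt
      refine (hj k (Finset.mem_univ _)).trans_lt ?_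
      rw [Polynomial.degree_eq_natDegree hjne]
      exact_mod_cast Nat.lt_succ_self _
    rw [coeff_C_mul, coeff_add, coeff_map, coeff_monomial, mul_add, Polynomial.coeff_add,
      Polynomial.coeff_mul_C, hk, zero_mul, zero_add]
    by_cases hkj : k = j
    · subst hkj
      simp [Polynomial.coeff_mul_X]
    · rw [if_neg (fun h => hkj (ha h)), if_neg hkj, mul_zero, Polynomial.coeff_zero]
  simp only [coeff_sum, Polynomial.finsetSum_coeff, h2] at h1
  simp at h1
  exact hjne h1

theorem natCard_setOf_forall_lt_le (D : ℕ) (s : Set (σ →₀ ℕ)) (hs : ∀ a ∈ s, ∀ i, a i < D) :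
    Nat.card s ≤ D ^ Fintype.card σ := by
  have : Nat.card (σ → Fin D) = D ^ Fintype.card σ := by classical simp
  rw [← this]
  refine Nat.card_le_card_of_injective (fun a i => ⟨a.1 i, hs a.1 a.2 i⟩) ?_
  intro a b hab
  ext i
  exact congrArg Fin.val (congrFun hab i)

theorem finite_setOf_sum_le (N : ℕ) : Finite {n : σ →₀ ℕ | (n.sum fun _ e => e) ≤ N} := by
  let b : Module.Basis {n : σ →₀ ℕ | (n.sum fun _ e => e) ≤ N} ℚ (restrictTotalDegree σ ℚ N) :=
    basisRestrictSupport ℚ _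
  exact Module.Finite.finite_basis b

theorem exists_relation_of_totalDegree_le {R : Type*} [CommRing R] [Nontrivial R] (N : ℕ)
    {ι : Type*} [Fintype ι] (v : ι → MvPolynomial σ R) (hv : ∀ k, (v k).totalDegree ≤ N)
    (hι : Nat.card {n : σ →₀ ℕ | (n.sum fun _ e => e) ≤ N} < Fintype.card ι) :
    ∃ c : ι → R, ∑ k, C (c k) * v k = 0 ∧ ∃ k, c k ≠ 0 := by
  let w : ι → restrictTotalDegree σ R N :=
    fun k => ⟨v k, (mem_restrictTotalDegree _ _ _).2 (hv k)⟩
  have hw : ¬ LinearIndependent R w := by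
    intro h
    have h1 := h.fintype_card_le_finrank
    have h2 : Module.finrank R (restrictTotalDegree σ R N) = _ :=
      Module.finrank_eq_nat_card_basis (basisRestrictSupport R _)
    rw [h2] at h1
    exact absurd hι (not_lt.2 h1)
  obtain ⟨c, hc0, hc⟩ := Fintype.not_linearIndependent_iff.1 hw
  refine ⟨c, ?_, hc⟩
  have h := congrArg (restrictTotalDegree σ R N).subtype hc0
  simp only [map_sum, map_smul, map_zero, smul_eq_C_mul] at h
  exact h

/-- More than `D ^ |σ|` polynomials over `K` are linearly dependent over `K[t]` modulo the
deformation of polynomials of degree at most `D`. -/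
theorem exists_relation_mod_powDeformation (f : σ → MvPolynomial σ K) (D : ℕ)
    (hf : ∀ i, (f i).totalDegree ≤ D) {ι : Type*} [Fintype ι] (q : ι → MvPolynomial σ K)
    (hι : D ^ Fintype.card σ < Fintype.card ι) :
    ∃ g : ι → Polynomial K, g ≠ 0 ∧
      ∑ j, C (g j) * map Polynomial.C (q j) ∈ Ideal.span (Set.range (powDeformation f D)) := by
  classical
  -- Up to degree `N`, all but at most `D ^ |σ|` monomials have an exponent at least `D`. The ideal
  -- elements attached to those in `T`, together with the `q j`, outnumber all monomials in `s`.
  let N := Finset.univ.sup fun j => (q j).totalDegree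
  let s : Set (σ →₀ ℕ) := {n | (n.sum fun _ e => e) ≤ N}
  have hsfin : Finite s := finite_setOf_sum_le N
  have := Fintype.ofFinite s
  let T := {a : s // ∃ i, D ≤ a.1 i}
  have hcard : Nat.card s ≤ Fintype.card T + D ^ Fintype.card σ := by
    have h1 : Nat.card {a : s // ¬ ∃ i, D ≤ a.1 i} ≤ D ^ Fintype.card σ := by
      refine le_trans ?_ (natCard_setOf_forall_lt_le D {a | a ∈ s ∧ ∀ i, a i < D} fun a h => h.2)
      have : Finite ↑{a | a ∈ s ∧ ∀ i, a i < D} := (Set.toFinite s).subset fun a h => h.1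
      refine Nat.card_le_card_of_injective
        (fun a => ⟨a.1.1, a.1.2, fun i => not_le.1 fun h => a.2 ⟨i, h⟩⟩) ?_
      intro a b hab
      exact Subtype.ext (Subtype.ext (Subtype.mk.inj hab))
    rw [← Nat.card_congr (Equiv.sumCompl fun a : s => ∃ i, D ≤ a.1 i), Nat.card_sum,
      ← Nat.card_eq_fintype_card]
    exact Nat.add_le_add_left h1 _
  choose ix hix using fun a : T => a.2
  let u : T → MvPolynomial σ K :=
    fun a => f (ix a) * monomial (a.1.1 - Finsupp.single (ix a) D) 1
  let v : T ⊕ ι → MvPolynomial σ (Polynomial K) := Sum.elim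
    (fun a => map Polynomial.C (u a) + monomial a.1.1 Polynomial.X)
    (fun j => map Polynomial.C (q j))
  obtain ⟨c, hc0, hc⟩ := exists_relation_of_totalDegree_le N v (by
    rintro (a | j)
    · exact (totalDegree_map_mul_monomial_add_monomial_le (f (ix a)) D (hf _) (ix a) a.1.1
        (hix a)).trans a.1.2
    · exact (totalDegree_map_le _ _).trans
        (Finset.le_sup (f := fun j => (q j).totalDegree) (Finset.mem_univ j)))
    (by
      rw [Fintype.card_sum]
      exact hcard.trans_lt (Nat.add_lt_add_left hι _))
  have hsum : ∑ a, C (c (Sum.inl a)) * (map Polynomial.C (u a) + monomial a.1.1 Polynomial.X) +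
      ∑ j, C (c (Sum.inr j)) * map Polynomial.C (q j) = 0 := by
    rw [← hc0, Fintype.sum_sum_type]
    rfl
  refine ⟨fun j => c (Sum.inr j), ?_, ?_⟩
  -- A relation not involving the `q j` would be one among the independent elements `u a + t X ^ a`.
  · intro h0
    have h0' : ∀ j, c (Sum.inr j) = 0 := congrFun h0
    simp only [h0', map_zero, zero_mul, Finset.sum_const_zero, add_zero] at hsum
    have h1 := eq_zero_of_sum_mul_map_add_monomial_eq_zero (fun a : T => a.1.1)
      (fun a b hab => Subtype.ext (Subtype.ext hab)) u _ hsum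
    obtain ⟨k, hk⟩ := hc
    rcases k with a | j
    · exact hk (congrFun h1 a)
    · exact hk (h0' j)
  · rw [eq_neg_of_add_eq_zero_right hsum]
    refine neg_mem (sum_mem fun a _ => Ideal.mul_mem_left _ _ ?_)
    exact map_mul_monomial_add_monomial_mem_span f D (ix a) a.1.1 (hix a)

/-! ### Heights of points and components of the deformation. -/

omit [Fintype σ] in
theorem comap_vanishingIdeal_singleton_translate (x y : σ → K) :
    ∃ e : MvPolynomial σ K ≃+* MvPolynomial σ K,
      (vanishingIdeal K {y}).comap e = vanishingIdeal K {x} := by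
  let t : (σ → K) → MvPolynomial σ K →ₐ[K] MvPolynomial σ K := fun v => aeval fun i => X i + C (v i)
  have ht : ∀ v w, v + w = 0 → (t v).comp (t w) = AlgHom.id K _ := by
    intro v w h
    ext1 i
    have hi : v i + w i = 0 := congrFun h i
    simp [t, add_assoc, ← C_add, hi]
  let e : MvPolynomial σ K ≃ₐ[K] MvPolynomial σ K :=
    AlgEquiv.ofAlgHom (t (x - y)) (t (y - x)) (ht _ _ (by abel)) (ht _ _ (by abel))
  refine ⟨e.toRingEquiv, ?_⟩
  ext p
  have h : (aeval y : MvPolynomial σ K →ₐ[K] K).comp (t (x - y)) = aeval x := by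
    ext i
    simp [t]
  rw [Ideal.mem_comap, mem_vanishingIdeal_singleton_iff, mem_vanishingIdeal_singleton_iff, ← h]
  rfl

variable [IsAlgClosed K]

/-- Some maximal ideal attains the Krull dimension; it is the ideal of a point by the
Nullstellensatz, and translations make all points alike. -/
theorem height_vanishingIdeal_singleton (x : σ → K) :
    (vanishingIdeal K {x}).height = Fintype.card σ := by
  have hdim : ringKrullDim (MvPolynomial σ K) = Fintype.card σ := by
    rw [MvPolynomial.ringKrullDim_of_isNoetherianRing, ringKrullDim_eq_zero_of_field, zero_add,
      Nat.card_eq_fintype_card]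
  have : FiniteRingKrullDim (MvPolynomial σ K) := by
    rw [finiteRingKrullDim_iff_ne_bot_and_top, hdim]
    exact ⟨WithBot.natCast_ne_bot _, by
      rw [← WithBot.coe_natCast, ← WithBot.coe_top, Ne, WithBot.coe_inj]
      exact ENat.natCast_ne_top _⟩
  obtain ⟨M, hM, hh⟩ := Ideal.exists_isMaximal_height (R := MvPolynomial σ K)
  obtain ⟨y, rfl⟩ := isMaximal_iff_eq_vanishingIdeal_singleton.1 hM
  obtain ⟨e, he⟩ := comap_vanishingIdeal_singleton_translate x y
  rw [← he, RingEquiv.height_comap]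
  rw [hdim] at hh
  exact_mod_cast hh

/-- Evaluation of the coefficients at `t = 0` and of the variables at `x`. -/
noncomputable def evalAtZero (x : σ → K) : MvPolynomial σ (Polynomial K) →+* K :=
  eval₂Hom (Polynomial.evalRingHom 0) x

omit [Fintype σ] [IsAlgClosed K] in
@[simp]
theorem evalAtZero_C (x : σ → K) (p : Polynomial K) : evalAtZero x (C p) = p.eval 0 := by
  simp [evalAtZero]

omit [Fintype σ] [IsAlgClosed K] in
@[simp]
theorem evalAtZero_X (x : σ → K) (i : σ) : evalAtZero x (X i) = x i := by
  simp [evalAtZero]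

omit [Fintype σ] [IsAlgClosed K] in
@[simp]
theorem evalAtZero_map_C (x : σ → K) (p : MvPolynomial σ K) :
    evalAtZero x (map Polynomial.C p) = eval x p := by
  have : (evalAtZero x).comp (map Polynomial.C) = eval x := by
    ext <;> simp
  rw [← this]
  rfl

/-- Treating `t` as one more variable, this is the ideal of the point `(0, x)`. -/
theorem height_ker_evalAtZero (x : σ → K) :
    (RingHom.ker (evalAtZero x)).height = Fintype.card σ + 1 := by
  have h := height_vanishingIdeal_singleton (K := K) (fun o : Option σ => o.elim 0 x)
  rw [Fintype.card_option, Nat.cast_add, Nat.cast_one] at h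
  rw [← h, ← RingEquiv.height_comap (optionEquivRight K σ).toRingEquiv]
  congr 1
  ext p
  rw [Ideal.mem_comap, mem_vanishingIdeal_singleton_iff, RingHom.mem_ker]
  have h2 : (evalAtZero x).comp (optionEquivRight K σ).toRingEquiv.toRingHom =
      (aeval (fun o : Option σ => o.elim 0 x) : MvPolynomial (Option σ) K →ₐ[K] K).toRingHom := by
    ext i
    · simp
    · rcases i with _ | i
      · simp
      · simp
  exact Eq.congr_left (congrArg (fun φ => φ p) h2)

/-- A prime ideal of `K[x]` with finite zero locus that vanishes at `x` is the ideal of `x`. -/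
theorem eq_vanishingIdeal_singleton_of_finite_zeroLocus (P : Ideal (MvPolynomial σ K))
    [hP : P.IsPrime] (hfin : (zeroLocus K P).Finite) (x : σ → K) (hx : x ∈ zeroLocus K P) :
    P = vanishingIdeal K {x} := by
  have h1 : P ≤ vanishingIdeal K {x} := le_zeroLocus_iff_le_vanishingIdeal.1
    (Set.singleton_subset_iff.2 hx)
  -- By the Nullstellensatz `P` contains a finite intersection of ideals of points, hence, being
  -- prime, one of them.
  have h2 : hfin.toFinset.inf (fun z => vanishingIdeal K {z}) ≤ P := by
    conv_rhs => rw [← IsPrime.vanishingIdeal_zeroLocus (K := K) P]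
    intro p hp z hz
    have := Finset.inf_le (f := fun z => vanishingIdeal K {z}) (hfin.mem_toFinset.2 hz) hp
    exact (mem_vanishingIdeal_singleton_iff z p).1 this
  obtain ⟨z, -, hz⟩ := (Ideal.IsPrime.inf_le' hP).1 h2
  have hzx : vanishingIdeal K {z} = vanishingIdeal K {x} :=
    Ideal.IsMaximal.eq_of_le inferInstance Ideal.IsPrime.ne_top' (hz.trans h1)
  exact le_antisymm h1 (hzx ▸ hz)

/-- Near an isolated zero, the deformation parameter vanishes on no component. -/
theorem exists_prime_notMem_of_finite (f : σ → MvPolynomial σ K) (D : ℕ)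
    (hfin : {x : σ → K | ∀ i, eval x (f i) = 0}.Finite) (x : σ → K)
    (hx : ∀ i, eval x (f i) = 0) :
    ∃ P : Ideal (MvPolynomial σ (Polynomial K)), P.IsPrime ∧
      Ideal.span (Set.range (powDeformation f D)) ≤ P ∧ P ≤ RingHom.ker (evalAtZero x) ∧
      C Polynomial.X ∉ P := by
  have hmax : (RingHom.ker (evalAtZero x)).IsPrime := RingHom.ker_isPrime _
  have hle : Ideal.span (Set.range (powDeformation f D)) ≤ RingHom.ker (evalAtZero x) := by
    rw [Ideal.span_le]
    rintro _ ⟨i, rfl⟩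
    simp [RingHom.mem_ker, powDeformation, hx]
  obtain ⟨P, hPmin, hPle⟩ := Ideal.exists_minimalPrimes_le hle
  have hP : P.IsPrime := hPmin.1.1
  refine ⟨P, hP, hPmin.1.2, hPle, fun ht => ?_⟩
  -- Krull's height theorem: `P` is minimal over at most `|σ|` generators.
  have hht : P.height ≤ Fintype.card σ := by
    refine (Ideal.height_le_card_of_mem_minimalPrimes_span (Set.finite_range _) hPmin).trans ?_
    have := Set.ncard_image_le (f := powDeformation f D) (Set.finite_univ)
    rw [Set.image_univ, Set.ncard_univ, Nat.card_eq_fintype_card] at this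
    exact_mod_cast this
  -- If `t ∈ P`, the contraction to `K[x]` contains every `f i`, so its zero locus is finite and it
  -- is the ideal of `x`. Then `P` contains the ideal of `(0, x)`, whose height `|σ| + 1` is too
  -- large.
  let Q : Ideal (MvPolynomial σ K) := P.comap (map Polynomial.C)
  have hfQ : ∀ i, f i ∈ Q := by
    intro i
    have h1 : powDeformation f D i ∈ P := hPmin.1.2 (Ideal.subset_span ⟨i, rfl⟩)
    exact (Ideal.add_mem_iff_left _ (Ideal.mul_mem_right _ _ ht)).1 h1
  have hQfin : (zeroLocus K Q).Finite := hfin.subset fun z hz i => hz _ (hfQ i)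
  have hxQ : x ∈ zeroLocus K Q := by
    intro p hp
    have := hPle hp
    rw [RingHom.mem_ker, evalAtZero_map_C] at this
    exact this
  have hQ := eq_vanishingIdeal_singleton_of_finite_zeroLocus Q hQfin x hxQ
  have hker : RingHom.ker (evalAtZero x) ≤ P := by
    intro s hs
    let s₀ := map (Polynomial.evalRingHom 0) s
    have hs₀ : s - map Polynomial.C s₀ ∈ P := by
      have : C Polynomial.X ∣ s - map Polynomial.C s₀ := by
        rw [C_dvd_iff_dvd_coeff]
        intro a
        rw [Polynomial.X_dvd_iff, coeff_sub, coeff_map, coeff_map]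
        simp [Polynomial.coeff_zero_eq_eval_zero]
      exact Ideal.mem_of_dvd _ this ht
    have h2 : s₀ ∈ Q := by
      rw [hQ, mem_vanishingIdeal_singleton_iff]
      have := hPle hs₀
      rw [RingHom.mem_ker, map_sub, hs, evalAtZero_map_C, zero_sub, neg_eq_zero] at this
      exact this
    have h3 : map Polynomial.C s₀ ∈ P := h2
    simpa using add_mem hs₀ h3
  have := (Ideal.height_mono hker).trans hht
  rw [height_ker_evalAtZero] at this
  exact absurd this (not_le.2 (by exact_mod_cast Nat.lt_succ_self _))

/-! ### Separating the zeros and Bézout's inequality. -/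

omit [Fintype σ] [IsAlgClosed K] in
theorem exists_eval_eq_ite (Z : Finset (σ → K)) (x : σ → K) :
    ∃ q : MvPolynomial σ K, eval x q = 1 ∧ ∀ y ∈ Z, y ≠ x → eval y q = 0 := by
  classical
  have h : ∀ y : σ → K, ∃ q : MvPolynomial σ K, eval x q = 1 ∧ (y ≠ x → eval y q = 0) := by
    intro y
    by_cases hy : y = x
    · exact ⟨1, map_one _, fun h => absurd hy h⟩
    · obtain ⟨i, hi⟩ := Function.ne_iff.1 hy
      refine ⟨C (x i - y i)⁻¹ * (X i - C (y i)), ?_, ?_⟩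
      · simpa using inv_mul_cancel₀ (sub_ne_zero.2 (Ne.symm hi))
      · simp
  choose q hq1 hq2 using h
  refine ⟨∏ y ∈ Z, q y, ?_, ?_⟩
  · rw [map_prod, Finset.prod_eq_one fun y _ => hq1 y]
  · intro y hy hyx
    rw [map_prod]
    exact Finset.prod_eq_zero hy (hq2 y hyx)

omit [Fintype σ] [IsAlgClosed K] in
theorem _root_.Polynomial.exists_eq_X_pow_mul_of_ne_zero {ι : Type*} [Fintype ι]
    (g : ι → Polynomial K) (hg : g ≠ 0) :
    ∃ (k : ℕ) (b : ι → Polynomial K), (∀ j, g j = Polynomial.X ^ k * b j) ∧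
      ∃ j, (b j).eval 0 ≠ 0 := by
  obtain ⟨j₀, hj₀⟩ := Function.ne_iff.1 hg
  have hex : ∃ k, ∃ j, (g j).coeff k ≠ 0 := by
    by_contra! h
    exact hj₀ (Polynomial.ext fun k => by simpa using h k j₀)
  classical
  have hmin : ∀ j, Polynomial.X ^ Nat.find hex ∣ g j := by
    intro j
    rw [Polynomial.X_pow_dvd_iff]
    intro d hd
    by_contra h
    exact Nat.find_min hex hd ⟨j, h⟩
  choose b hb using hmin
  obtain ⟨j, hj⟩ := Nat.find_spec hex
  refine ⟨_, b, hb, j, ?_⟩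
  rw [hb j, mul_comm, Polynomial.coeff_mul_X_pow', if_pos le_rfl, Nat.sub_self] at hj
  rwa [← Polynomial.coeff_zero_eq_eval_zero]

/-- **Bézout's inequality** for a finite set of zeros of as many polynomials as variables. -/
theorem ncard_zeros_le_pow (f : σ → MvPolynomial σ K) (D : ℕ)
    (hf : ∀ i, (f i).totalDegree ≤ D)
    (hfin : {x : σ → K | ∀ i, eval x (f i) = 0}.Finite) :
    {x : σ → K | ∀ i, eval x (f i) = 0}.ncard ≤ D ^ Fintype.card σ := by
  classical
  by_contra! hlt
  rw [Set.ncard_eq_toFinset_card _ hfin, ← Fintype.card_coe] at hlt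
  choose q hq1 hq2 using fun z : hfin.toFinset => exists_eval_eq_ite hfin.toFinset z.1
  obtain ⟨g, hg0, hg⟩ := exists_relation_mod_powDeformation f D hf q hlt
  obtain ⟨k, b, hb, z, hz⟩ := Polynomial.exists_eq_X_pow_mul_of_ne_zero g hg0
  obtain ⟨P, hP, hFP, hPx, ht⟩ :=
    exists_prime_notMem_of_finite f D hfin z.1 (hfin.mem_toFinset.1 z.2)
  -- The relation lies in the prime `P` and `t` does not, so the factor `t ^ k` cancels. Evaluating
  -- at `t = 0` and at the zero `z` leaves only `b z` at `0`.
  have h1 : C Polynomial.X ^ k * ∑ j, C (b j) * map Polynomial.C (q j) ∈ P := by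
    convert! hFP hg using 1
    rw [Finset.mul_sum]
    refine Finset.sum_congr rfl fun j _ => ?_
    rw [hb j, C_mul, C_pow, mul_assoc]
  have h2 := (hP.mem_or_mem h1).resolve_left fun h => ht (hP.mem_of_pow_mem k h)
  have h3 := hPx h2
  rw [RingHom.mem_ker, map_sum, Finset.sum_eq_single z] at h3
  · rw [map_mul, evalAtZero_C, evalAtZero_map_C, hq1, mul_one] at h3
    exact hz h3
  · intro j _ hj
    rw [map_mul, evalAtZero_map_C, hq2 j z.1 z.2 (fun h => hj (Subtype.ext h.symm)), mul_zero]
  · simp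

end MvPolynomial

/-! ### Zariski topology, polynomial maps and the Nullstellensatz. -/

namespace DecompInterp

variable {σ τ F K : Type*} [Field F] [Field K] [Algebra F K]

theorem isClosed_zariski_iff {V : Set (σ → K)} :
    @IsClosed _ (zariskiTopology σ K) V ↔ ∃ I : Ideal (MvPolynomial σ K), zeroLocus K I = V := by
  rw [← @isOpen_compl_iff _ _ (zariskiTopology σ K)]
  change Vᶜᶜ ∈ Set.range _ ↔ _
  rw [compl_compl]
  rfl

/-- The polynomial map `K^τ → K^σ` with components `q`. -/
noncomputable def polyMap (K : Type*) [Field K] [Algebra F K] (q : σ → MvPolynomial τ F)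
    (x : τ → K) : σ → K := fun c => aeval x (q c)

theorem aeval_polyMap (q : σ → MvPolynomial τ F) (x : τ → K) (p : MvPolynomial σ K) :
    aeval (polyMap K q x) p = aeval x (bind₁ (fun c => map (algebraMap F K) (q c)) p) := by
  rw [aeval_bind₁]
  congr 2
  funext c
  rw [aeval_map_algebraMap]
  rfl

theorem continuous_polyMap (q : σ → MvPolynomial τ F) :
    @Continuous _ _ (zariskiTopology τ K) (zariskiTopology σ K) (polyMap K q) := by
  let _ := zariskiTopology τ K
  let _ := zariskiTopology σ K
  refine continuous_iff_isClosed.2 fun V hV => ?_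
  obtain ⟨I, rfl⟩ := isClosed_zariski_iff.1 hV
  refine isClosed_zariski_iff.2
    ⟨I.map (bind₁ fun c => map (algebraMap F K) (q c)).toRingHom, ?_⟩
  rw [Ideal.map, zeroLocus_span]
  ext x
  simp only [Set.forall_mem_image, Set.mem_ofPred_eq, Set.mem_preimage, mem_zeroLocus_iff,
    aeval_polyMap, SetLike.mem_coe]
  rfl

theorem continuous_comp_zariski (ι : τ → σ) :
    @Continuous _ _ (zariskiTopology σ K) (zariskiTopology τ K) (fun y : σ → K => y ∘ ι) := by
  have h : (fun y : σ → K => y ∘ ι) = polyMap K (fun t => (X (ι t) : MvPolynomial σ K)) := by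
    funext y t
    simp [polyMap]
  rw [h]
  exact continuous_polyMap _

theorem vanishingIdeal_isPrime_of_isIrreducible {V : Set (σ → K)}
    (hV : IsZariskiIrreducible V) : (vanishingIdeal K V).IsPrime := by
  let _ := zariskiTopology σ K
  have hirr : IsIrreducible V := hV
  have hclosed : ∀ p : MvPolynomial σ K, IsClosed {x : σ → K | aeval x p = 0} := fun p =>
    isClosed_zariski_iff.2 ⟨Ideal.span {p}, by rw [zeroLocus_span]; simp⟩
  refine ⟨fun h => ?_, fun {p q} hpq => ?_⟩
  · obtain ⟨x, hx⟩ := hirr.1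
    have h1 : (1 : MvPolynomial σ K) ∈ vanishingIdeal K V := h ▸ Submodule.mem_top
    simpa using h1 x hx
  · refine (isPreirreducible_iff_isClosed_union_isClosed.1 hirr.2 _ _ (hclosed p) (hclosed q) ?_)
    intro x hx
    have := hpq x hx
    rwa [map_mul, mul_eq_zero] at this

theorem isIrreducible_zeroLocus [IsAlgClosed K] [Finite σ] (P : Ideal (MvPolynomial σ K))
    [hP : P.IsPrime] : IsZariskiIrreducible (zeroLocus K P) := by
  let _ := zariskiTopology σ K
  refine ⟨?_, isPreirreducible_iff_isClosed_union_isClosed.2 fun A B hA hB hAB => ?_⟩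
  · by_contra h
    rw [Set.not_nonempty_iff_eq_empty] at h
    have := IsPrime.vanishingIdeal_zeroLocus (K := K) P
    rw [h, vanishingIdeal_empty] at this
    exact hP.ne_top this.symm
  · obtain ⟨I, rfl⟩ := isClosed_zariski_iff.1 hA
    obtain ⟨J, rfl⟩ := isClosed_zariski_iff.1 hB
    have hIJ : I * J ≤ P := by
      rw [← IsPrime.vanishingIdeal_zeroLocus (K := K) P, ← le_zeroLocus_iff_le_vanishingIdeal]
      intro x hx
      rcases hAB hx with h | h
      · exact zeroLocus_anti_mono Ideal.mul_le_left h
      · exact zeroLocus_anti_mono Ideal.mul_le_right h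
    exact (hP.mul_le.1 hIJ).imp zeroLocus_anti_mono zeroLocus_anti_mono

theorem isIrreducible_univ_zariski [IsAlgClosed K] [Finite σ] :
    IsZariskiIrreducible (Set.univ : Set (σ → K)) := by
  have := isIrreducible_zeroLocus (⊥ : Ideal (MvPolynomial σ K))
  rwa [zeroLocus_bot] at this

/-- The Nullstellensatz correspondence between irreducible closed sets and prime ideals. -/
noncomputable def irreducibleClosedsOrderIso (σ K : Type*) [Field K] [IsAlgClosed K] [Finite σ] :
    @TopologicalSpace.IrreducibleCloseds (σ → K) (zariskiTopology σ K) ≃o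
      (PrimeSpectrum (MvPolynomial σ K))ᵒᵈ :=
  let _ := zariskiTopology σ K
  have hcl : ∀ V : TopologicalSpace.IrreducibleCloseds (σ → K),
      zeroLocus K (vanishingIdeal K (V : Set (σ → K))) = V := by
    intro V
    obtain ⟨I, hI⟩ := isClosed_zariski_iff.1 V.isClosed
    refine le_antisymm ?_ (zeroLocus_vanishingIdeal_le _)
    conv_rhs => rw [← hI]
    refine zeroLocus_anti_mono ?_
    rw [← hI]
    exact le_vanishingIdeal_zeroLocus I
  { toFun := fun V => OrderDual.toDual ⟨vanishingIdeal K (V : Set (σ → K)),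
      vanishingIdeal_isPrime_of_isIrreducible V.isIrreducible⟩
    invFun := fun P =>
      ⟨zeroLocus K (OrderDual.ofDual P).asIdeal,
        isIrreducible_zeroLocus (OrderDual.ofDual P).asIdeal, isClosed_zariski_iff.2 ⟨_, rfl⟩⟩
    left_inv := fun V => TopologicalSpace.IrreducibleCloseds.ext (hcl V)
    right_inv := fun P => by
      refine PrimeSpectrum.ext ?_
      exact IsPrime.vanishingIdeal_zeroLocus (K := K) (OrderDual.ofDual P).asIdeal
    map_rel_iff' := by
      intro V W
      refine ⟨fun h => ?_, fun h => vanishingIdeal_anti_mono h⟩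
      have h' : vanishingIdeal K (W : Set (σ → K)) ≤ vanishingIdeal K (V : Set (σ → K)) := h
      have := zeroLocus_anti_mono (K := K) h'
      rw [hcl, hcl] at this
      exact this }

theorem topologicalKrullDim_zariski (σ K : Type*) [Field K] [IsAlgClosed K] [Finite σ] :
    @topologicalKrullDim (σ → K) (zariskiTopology σ K) = (Nat.card σ : ℕ) := by
  let _ := zariskiTopology σ K
  have h := Order.krullDim_eq_of_orderIso (irreducibleClosedsOrderIso σ K)
  rw [Order.krullDim_orderDual] at h
  refine h.trans ?_
  have h2 : ringKrullDim (MvPolynomial σ K) = (Nat.card σ : ℕ) := by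
    rw [MvPolynomial.ringKrullDim_of_isNoetherianRing, ringKrullDim_eq_zero_of_field, zero_add]
  exact h2

/-! ### Graphs: polynomial maps with all parameters among their components. -/

section Graph

variable (q : σ → MvPolynomial τ F) (ι : τ → σ) (hq : ∀ t, q (ι t) = X t)

include hq

theorem polyMap_comp_eq (x : τ → K) : polyMap K q x ∘ ι = x := by
  funext t
  simp [polyMap, hq]

omit hq in
theorem isZariskiIrreducible_range_polyMap [IsAlgClosed K] [Finite τ] :
    IsZariskiIrreducible (Set.range (polyMap K q)) := by
  let _ := zariskiTopology τ K
  let _ := zariskiTopology σ K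
  rw [← Set.image_univ]
  exact IsIrreducible.image isIrreducible_univ_zariski _ (continuous_polyMap q).continuousOn

/-- Restriction to the coordinates `ι` is a continuous left inverse, so the map is a homeomorphism
onto its range. -/
theorem zariskiDim_range_polyMap [IsAlgClosed K] [Finite τ] :
    zariskiDim (Set.range (polyMap K q)) = (Nat.card τ : ℕ) := by
  let _ := zariskiTopology τ K
  let _ := zariskiTopology σ K
  rw [← topologicalKrullDim_zariski τ K]
  have h1 : Continuous (polyMap K q) := continuous_polyMap q
  have h2 : Continuous (fun y : σ → K => y ∘ ι) := continuous_comp_zariski ι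
  have h3 : Topology.IsEmbedding (polyMap K q) :=
    Function.LeftInverse.isEmbedding (f := fun y : σ → K => y ∘ ι)
      (fun x => polyMap_comp_eq q ι hq x) h2 h1
  exact (h3.toHomeomorph.isHomeomorph.topologicalKrullDim_eq _).symm

theorem isDefinedOver_range_polyMap [Infinite K] :
    IsDefinedOver F (Set.range (polyMap K q)) := by
  let I : Ideal (MvPolynomial σ F) := Ideal.span (Set.range fun c => X c - rename ι (q c))
  have hI : zeroLocus K I = Set.range (polyMap K q) := by
    rw [zeroLocus_span]
    ext y
    simp only [Set.forall_mem_range, Set.mem_ofPred_eq, map_sub, aeval_X, aeval_rename, sub_eq_zero]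
    constructor
    · exact fun h => ⟨y ∘ ι, funext fun c => (h c).symm⟩
    · rintro ⟨x, rfl⟩ c
      rw [polyMap_comp_eq q ι hq]
      rfl
  refine ⟨I, hI, le_antisymm ?_ ?_⟩
  · intro p hp
    let J := I.map (map (algebraMap F K))
    -- `r` replaces each coordinate by its expression in the parameters; it is the identity modulo
    -- `J`. If `p` vanishes on the graph, substitution gives a polynomial vanishing on all of `K ^
    -- τ`, hence zero since `K` is infinite, so `p ∈ J`.
    let r : MvPolynomial σ K →ₐ[K] MvPolynomial σ K :=
      (rename ι).comp (bind₁ fun c => map (algebraMap F K) (q c))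
    have hr : (Ideal.Quotient.mkₐ K J).comp r = Ideal.Quotient.mkₐ K J := by
      ext c
      simp only [AlgHom.comp_apply, r, bind₁_X_right]
      refine (Ideal.Quotient.eq.2 ?_).symm
      have : (X c - rename ι (q c) : MvPolynomial σ F) ∈ I := Ideal.subset_span ⟨c, rfl⟩
      have := Ideal.mem_map_of_mem (map (algebraMap F K)) this
      rwa [map_sub, map_X, map_rename] at this
    have hp0 : bind₁ (fun c => map (algebraMap F K) (q c)) p = 0 := by
      refine MvPolynomial.funext fun x => ?_
      have := hp _ ⟨x, rfl⟩
      rw [aeval_polyMap] at this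
      rw [map_zero, ← this]
      rfl
    have hrp : r p = 0 := by
      simp only [r, AlgHom.comp_apply, hp0, map_zero]
    have := congrArg (fun φ => φ p) hr
    simp only [AlgHom.comp_apply, hrp, map_zero] at this
    exact Ideal.Quotient.eq_zero_iff_mem.1 this.symm
  · rw [Ideal.map_le_iff_le_comap]
    intro p hp
    rw [Ideal.mem_comap, mem_vanishingIdeal_iff, ← hI]
    intro y hy
    rw [aeval_map_algebraMap]
    exact hy p hp

end Graph

/-! ### The composition as a polynomial expression, and its degree. -/

section EvalComp

variable {A B : Type*} [CommRing A] [CommRing B] {d e : ℕ}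

/-- The value at `a` of `g ∘ h`, where `g` is monic of degree `d` with lower coefficients
`g 0, …, g (d - 1)` and `h` is monic original of degree `e` with lower coefficients
`h 0, …, h (e - 2)` in degrees `1, …, e - 1`. -/
def evalComp (g : Fin d → A) (h : Fin (e - 1) → A) (a : A) : A :=
  (a ^ e + ∑ j, h j * a ^ (j.1 + 1)) ^ d +
    ∑ i, g i * (a ^ e + ∑ j, h j * a ^ (j.1 + 1)) ^ i.1

theorem map_evalComp (φ : A →+* B) (g : Fin d → A) (h : Fin (e - 1) → A) (a : A) :
    φ (evalComp g h a) = evalComp (fun i => φ (g i)) (fun j => φ (h j)) (φ a) := by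
  simp [evalComp]

theorem totalDegree_evalComp_le {τ : Type*} (he : 1 ≤ e)
    (g : Fin d → MvPolynomial τ A) (h : Fin (e - 1) → MvPolynomial τ A) (a : MvPolynomial τ A)
    (hg : ∀ i, (g i).totalDegree ≤ 1) (hh : ∀ j, (h j).totalDegree ≤ 1)
    (ha : a.totalDegree ≤ 1) : (evalComp g h a).totalDegree ≤ d * e := by
  have hpow : ∀ k, (a ^ k).totalDegree ≤ k := fun k =>
    (totalDegree_pow a k).trans (by simpa using Nat.mul_le_mul_left k ha)
  have hin : (a ^ e + ∑ j, h j * a ^ (j.1 + 1)).totalDegree ≤ e := by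
    refine (totalDegree_add _ _).trans (max_le (hpow e) (totalDegree_finsetSum_le fun j _ => ?_))
    refine (totalDegree_mul _ _).trans ((add_le_add (hh j) (hpow _)).trans ?_)
    have := j.2
    omega
  refine (totalDegree_add _ _).trans (max_le ?_ (totalDegree_finsetSum_le fun i _ => ?_))
  · exact (totalDegree_pow _ _).trans (Nat.mul_le_mul_left d hin)
  · refine (totalDegree_mul _ _).trans ((add_le_add (hg i)
      ((totalDegree_pow _ _).trans (Nat.mul_le_mul_left _ hin))).trans ?_)
    -- The extra degree of the coefficient `g i` is absorbed because `1 ≤ e` and `i < d`.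
    calc 1 + i.1 * e ≤ e + i.1 * e := Nat.add_le_add_right he _
      _ = (i.1 + 1) * e := by ring
      _ ≤ d * e := Nat.mul_le_mul_right e i.2

end EvalComp

/-! ### The incidence variety as a graph, and its linear sections. -/

section Incidence

variable {F K : Type*} [Field F] [Field K] [Algebra F K] {d e : ℕ}

theorem eval_of_mem_monicPolys {g : Polynomial K} (hg : g ∈ monicPolys K d) (a : K) :
    g.eval a = a ^ d + ∑ i : Fin d, g.coeff i * a ^ i.1 := by
  obtain ⟨hm, rfl⟩ := hg
  conv_lhs => rw [hm.as_sum]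
  rw [Polynomial.eval_add, Polynomial.eval_finsetSum, Finset.sum_range]
  simp

theorem eval_of_mem_monicOriginalPolys (he : 1 ≤ e) {h : Polynomial K}
    (hh : h ∈ monicOriginalPolys K e) (a : K) :
    h.eval a = a ^ e + ∑ j : Fin (e - 1), h.coeff (j + 1) * a ^ (j.1 + 1) := by
  obtain ⟨k, rfl⟩ := Nat.exists_eq_add_of_le' he
  rw [eval_of_mem_monicPolys hh.1, Fin.sum_univ_succ]
  simp [hh.2]

theorem exists_mem_monicPolys (c : Fin d → K) :
    ∃ g ∈ monicPolys K d, ∀ i : Fin d, g.coeff i = c i := by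
  have hlt := Polynomial.degree_sum_fin_lt c
  refine ⟨Polynomial.X ^ d + ∑ i : Fin d, Polynomial.C (c i) * Polynomial.X ^ i.1,
    ⟨Polynomial.monic_X_pow_add hlt, ?_⟩, fun i => ?_⟩
  · rw [Polynomial.natDegree_add_eq_left_of_degree_lt, Polynomial.natDegree_X_pow]
    rwa [Polynomial.degree_X_pow]
  · simp [Polynomial.coeff_X_pow, i.2.ne, Polynomial.finsetSum_coeff,
      Fin.val_inj]

theorem exists_mem_monicOriginalPolys (he : 1 ≤ e) (c : Fin (e - 1) → K) :
    ∃ h ∈ monicOriginalPolys K e, ∀ j : Fin (e - 1), h.coeff (j + 1) = c j := by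
  obtain ⟨k, rfl⟩ := Nat.exists_eq_add_of_le' he
  obtain ⟨h, hh, hc⟩ := exists_mem_monicPolys (Fin.cons 0 c : Fin (k + 1) → K)
  exact ⟨h, ⟨hh, hc 0⟩, fun j => hc j.succ⟩

theorem eval_comp_eq_evalComp (he : 1 ≤ e) {g h : Polynomial K} (hg : g ∈ monicPolys K d)
    (hh : h ∈ monicOriginalPolys K e) (a : K) :
    (g.comp h).eval a =
      evalComp (fun i : Fin d => g.coeff i) (fun j : Fin (e - 1) => h.coeff (j + 1)) a := by
  rw [Polynomial.eval_comp, eval_of_mem_monicPolys hg, eval_of_mem_monicOriginalPolys he hh,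
    evalComp]

theorem mem_incidenceVariety_iff (he : 1 ≤ e) (y : CoordIndex d e → K) :
    y ∈ incidenceVariety K d e ↔ ∀ i, evalComp (fun i => y (Sum.inl i))
      (fun j => y (Sum.inr (Sum.inl j))) (y (Sum.inr (Sum.inr (Sum.inl i)))) =
        y (Sum.inr (Sum.inr (Sum.inr i))) := by
  constructor
  · rintro ⟨⟨g, h, α, β⟩, ⟨hg, hh, hi⟩, rfl⟩ i
    exact (eval_comp_eq_evalComp he hg hh (α i)).symm.trans (hi i)
  · intro hy
    obtain ⟨g, hg, hgc⟩ := exists_mem_monicPolys fun i : Fin d => y (Sum.inl i)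
    obtain ⟨h, hh, hhc⟩ := exists_mem_monicOriginalPolys he
      fun j : Fin (e - 1) => y (Sum.inr (Sum.inl j))
    refine ⟨⟨g, h, fun i => y (Sum.inr (Sum.inr (Sum.inl i))),
      fun i => y (Sum.inr (Sum.inr (Sum.inr i)))⟩, ⟨hg, hh, fun i => ?_⟩, ?_⟩
    · rw [eval_comp_eq_evalComp he hg hh]
      simp only [hgc, hhc]
      exact hy i
    · funext c
      rcases c with i | j | i | i
      · exact hgc i
      · exact hhc j
      · rfl
      · rfl

/-- The coordinates `g`, `h` and `α`, which parametrize the incidence variety. -/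
abbrev ParamIndex (d e : ℕ) : Type := Fin d ⊕ Fin (e - 1) ⊕ Fin (d + e - 1)

/-- The inclusion of the parameters among all coordinates. -/
def paramCoord : ParamIndex d e → CoordIndex d e :=
  Sum.elim Sum.inl (Sum.elim (Sum.inr ∘ Sum.inl) (Sum.inr ∘ Sum.inr ∘ Sum.inl))

/-- The coordinates of the point of the incidence variety with given `g`, `h` and `α`. -/
noncomputable def incidenceParam (F : Type*) [Field F] (d e : ℕ) :
    CoordIndex d e → MvPolynomial (ParamIndex d e) F :=
  Sum.elim (fun i => X (Sum.inl i)) (Sum.elim (fun j => X (Sum.inr (Sum.inl j)))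
    (Sum.elim (fun i => X (Sum.inr (Sum.inr i)))
      (fun i => evalComp (fun i => X (Sum.inl i)) (fun j => X (Sum.inr (Sum.inl j)))
        (X (Sum.inr (Sum.inr i))))))

theorem incidenceParam_paramCoord (t : ParamIndex d e) :
    incidenceParam F d e (paramCoord t) = X t := by
  rcases t with i | j | i <;> rfl

theorem polyMap_incidenceParam_last (x : ParamIndex d e → K) (i : Fin (d + e - 1)) :
    polyMap K (incidenceParam F d e) x (Sum.inr (Sum.inr (Sum.inr i))) =
      evalComp (fun i => x (Sum.inl i)) (fun j => x (Sum.inr (Sum.inl j)))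
        (x (Sum.inr (Sum.inr i))) := by
  refine (map_evalComp (aeval x : MvPolynomial (ParamIndex d e) F →ₐ[F] K).toRingHom _ _ _).trans ?_
  simp

theorem incidenceVariety_eq_range (F : Type*) [Field F] [Algebra F K] (he : 1 ≤ e) :
    incidenceVariety K d e = Set.range (polyMap K (incidenceParam F d e)) := by
  have hpt : ∀ (x : ParamIndex d e → K) t,
      polyMap K (incidenceParam F d e) x (paramCoord t) = x t := fun x t =>
    congrFun (polyMap_comp_eq (incidenceParam F d e) paramCoord incidenceParam_paramCoord x) t
  ext y
  rw [mem_incidenceVariety_iff he]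
  constructor
  · intro hy
    refine ⟨y ∘ paramCoord, funext fun c => ?_⟩
    rcases c with i | j | i | i
    · exact hpt _ (Sum.inl i)
    · exact hpt _ (Sum.inr (Sum.inl j))
    · exact hpt _ (Sum.inr (Sum.inr i))
    · exact (polyMap_incidenceParam_last _ i).trans (hy i)
  · rintro ⟨x, rfl⟩ i
    rw [polyMap_incidenceParam_last]
    congr 1
    · exact funext fun i => hpt x (Sum.inl i)
    · exact funext fun j => hpt x (Sum.inr (Sum.inl j))
    · exact hpt x (Sum.inr (Sum.inr i))

/-- An affine subspace of dimension `m` is parametrized by polynomials of degree at most one. -/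
theorem exists_affine_parametrization {σ : Type*} [Finite σ] {m : ℕ}
    (E : AffineSubspace K (σ → K)) (hE : (E : Set (σ → K)).Nonempty)
    (hm : Module.finrank K E.direction = m) :
    ∃ l : σ → MvPolynomial (Fin m) K, (∀ c, (l c).totalDegree ≤ 1) ∧
      Function.Injective (polyMap K l) ∧ Set.range (polyMap K l) = E := by
  obtain ⟨y₀, hy₀⟩ := hE
  let b := Module.finBasisOfFinrankEq K E.direction hm
  let l : σ → MvPolynomial (Fin m) K := fun c => C (y₀ c) + ∑ k, C ((b k : σ → K) c) * X k
  have hl : ∀ x, polyMap K l x = (b.equivFun.symm x : σ → K) + y₀ := by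
    intro x
    funext c
    rw [Module.Basis.equivFun_symm_apply, add_comm]
    simp [polyMap, l, mul_comm]
  refine ⟨l, fun c => ?_, fun x x' h => ?_, ?_⟩
  · refine (totalDegree_add _ _).trans (max_le (by simp) (totalDegree_finsetSum_le fun k _ => ?_))
    refine (totalDegree_mul _ _).trans ?_
    simp
  · rw [hl, hl] at h
    exact b.equivFun.symm.injective (Subtype.ext (add_right_cancel h))
  · ext y
    constructor
    · rintro ⟨x, rfl⟩
      rw [hl]
      exact AffineSubspace.vadd_mem_of_mem_direction (b.equivFun.symm x).2 hy₀
    · intro hy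
      refine ⟨b.equivFun ⟨y - y₀, AffineSubspace.vsub_mem_direction hy hy₀⟩, ?_⟩
      rw [hl, LinearEquiv.symm_apply_apply, sub_add_cancel]

theorem encard_incidenceVariety_inter_le [IsAlgClosed K] (hd : 1 ≤ d) (he : 1 ≤ e)
    (E : AffineSubspace K (CoordIndex d e → K)) (hE : (E : Set (CoordIndex d e → K)).Nonempty)
    (hm : Module.finrank K E.direction = d + e - 1)
    (hfin : (incidenceVariety K d e ∩ E).Finite) :
    (incidenceVariety K d e ∩ E).encard ≤ (((d * e) ^ (d + e - 1) : ℕ) : ℕ∞) := by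
  obtain ⟨l, hl1, hlinj, hlE⟩ := exists_affine_parametrization E hE hm
  -- Pull the equations back to `E`: `d + e - 1` equations in as many unknowns. The entries of `l`
  -- have degree at most one, so each equation has degree at most `d * e`.
  let f : Fin (d + e - 1) → MvPolynomial (Fin (d + e - 1)) K := fun i =>
    evalComp (fun i => l (Sum.inl i)) (fun j => l (Sum.inr (Sum.inl j)))
      (l (Sum.inr (Sum.inr (Sum.inl i)))) - l (Sum.inr (Sum.inr (Sum.inr i)))
  have hf : ∀ i, (f i).totalDegree ≤ d * e := fun i =>
    (totalDegree_sub _ _).trans (max_le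
      (totalDegree_evalComp_le he _ _ _ (fun _ => hl1 _) (fun _ => hl1 _) (hl1 _))
      ((hl1 _).trans (Nat.mul_pos hd he)))
  have hzero : {x | ∀ i, eval x (f i) = 0} = polyMap K l ⁻¹' incidenceVariety K d e := by
    ext x
    rw [Set.mem_preimage, mem_incidenceVariety_iff he]
    refine forall_congr' fun i => ?_
    rw [map_sub, sub_eq_zero, map_evalComp]
    rfl
  have himage : incidenceVariety K d e ∩ E = polyMap K l '' {x | ∀ i, eval x (f i) = 0} := by
    rw [hzero, Set.image_preimage_eq_inter_range, hlE]
  rw [himage] at hfin ⊢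
  have hfin' := hfin.of_finite_image hlinj.injOn
  rw [hlinj.encard_image, ← hfin'.cast_ncard_eq]
  have := ncard_zeros_le_pow f (d * e) hf hfin'
  rw [Fintype.card_fin] at this
  exact_mod_cast this

end Incidence

end DecompInterp

theorem mainTheorem9 {F K : Type*} [Field F] [Field K] [Algebra F K] [IsAlgClosure F K]
    (n d e : ℕ) (hd : 1 ≤ d) (he : 1 ≤ e) (hn : n = d * e) :
    DecompInterp.IsDefinedOver F (DecompInterp.incidenceVariety K d e) ∧
    DecompInterp.IsZariskiIrreducible (DecompInterp.incidenceVariety K d e) ∧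
    DecompInterp.zariskiDim (DecompInterp.incidenceVariety K d e) =
      ((2 * (d + e - 1) : ℕ) : WithBot ℕ∞) ∧
    DecompInterp.degreeOfIrreducible (DecompInterp.incidenceVariety K d e) ≤
      ((n ^ (d + e - 1) : ℕ) : ℕ∞) := by
  have : IsAlgClosed K := IsAlgClosure.isAlgClosed F
  have hinf : Infinite K := inferInstance
  have hrange := DecompInterp.incidenceVariety_eq_range (K := K) (d := d) F he
  have hdim : DecompInterp.zariskiDim (DecompInterp.incidenceVariety K d e) =
      ((2 * (d + e - 1) : ℕ) : WithBot ℕ∞) := by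
    rw [hrange, DecompInterp.zariskiDim_range_polyMap _ DecompInterp.paramCoord
      DecompInterp.incidenceParam_paramCoord]
    congr 1
    simp only [Nat.card_eq_fintype_card, Fintype.card_sum, Fintype.card_fin]
    omega
  refine ⟨?_, ?_, hdim, ?_⟩
  · rw [hrange]
    exact DecompInterp.isDefinedOver_range_polyMap _ DecompInterp.paramCoord
      DecompInterp.incidenceParam_paramCoord
  · rw [hrange]
    exact DecompInterp.isZariskiIrreducible_range_polyMap _
  · refine sSup_le ?_
    rintro _ ⟨E, hE, hEdim, hfin, rfl⟩
    rw [hn]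
    refine DecompInterp.encard_incidenceVariety_inter_le hd he E hE ?_ hfin
    rw [hdim, Nat.card_eq_fintype_card] at hEdim
    simp only [Fintype.card_sum, Fintype.card_fin] at hEdim
    -- The ambient dimension is `3 * (d + e - 1)`, as `1 ≤ e` makes `e - 1` a true difference; hence
    -- `E` has dimension `d + e - 1`.
    have : Module.finrank K E.direction + 2 * (d + e - 1) =
        d + (e - 1 + (d + e - 1 + (d + e - 1))) := by exact_mod_cast hEdim
    omega
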